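/- Let $\mathbb F$ be any field, and let the atoms $\mathbb A$ be either the equality atoms $(\mathbb N,=)$, whose automorphisms are all permutations of $\mathbb N$, or the ordered atoms $(\mathbb Q,<)$, whose automorphisms are all order-preserving bijections of $\mathbb Q$. An object $x$ built from atoms, on which atom automorphisms act, is \emph{finitely supported} if there is a finite tuple $\bar a$ of atoms such that every automorphism $\pi$ with $\pi(\bar a)=\bar a$ (an $\bar a$-automorphism) satisfies $\pi(x)=x$. A \emph{set with atoms} is a finitely supported set all of whose elements (and their elements, and so on) are finitely supported. It is \emph{orbit-finite} if, for some tuple $\bar a$, it is a finite union of orbits under the group of $\bar a$-automorphisms. A \emph{vector space with atoms} is a vector space over $\mathbb F$ whose underlying set $V$ is a set with atoms and whose addition $V\times V\to V$ and scalar multiplication $\mathbb F\times V\to V$ are finitely supported, where atom automorphisms fix every element of $\mathbb F$. It is \emph{orbit-finitely spanned} if some orbit-finite subset of $V$ spans it. The \emph{finitely supported dual} of $V$ is the vector space with atoms of all finitely supported linear maps $V\to\mathbb F$, with pointwise addition and scalar multiplication; here a map is identified with its graph, a subset of $V\times\mathbb F$. Then for every orbit-finitely spanned vector space with atoms $V$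 (not necessarily equivariant), the finitely supported dual of $V$ is orbit-finitely spanned. -/

import Mathlib

open scoped Pointwise

universe u

namespace Atoms

/-! Throughout, `A` is the set of atoms and `G` is its group of atom automorphisms. Tuples of atoms
matter only through the finite set of their entries, so they are represented by `S : Finset A`; the
automorphisms fixing the tuple form `fixingSubgroup G (S : Set A)`. Any type with a `G`-action plays
the role of the universe in which sets with atoms live. -/

/-- An element (for instance a subset) is finitely supported if it is fixed by all automorphisms
that fix some finite set of atoms pointwise. -/
def FinitelySupported (G A : Type*) [Group G] [MulAction G A] {E : Type*} [MulAction G E]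
    (x : E) : Prop :=
  ∃ S : Finset A, MulAction.Supports G (S : Set A) x

/-- A set with atoms: a finitely supported set all of whose elements are finitely supported.
The action on subsets is the pointwise one, `π • X = {π • x | x ∈ X}`. -/
def IsSetWithAtoms (G A : Type*) [Group G] [MulAction G A] {E : Type*} [MulAction G E]
    (X : Set E) : Prop :=
  FinitelySupported G A X ∧ ∀ x ∈ X, FinitelySupported G A x

/-- A set with atoms is orbit-finite if, for some tuple of atoms, it is a finite union of orbits
under the automorphisms fixing this tuple. -/
def OrbitFinite (G A : Type*) [Group G] [MulAction G A] {E : Type*} [MulAction G E]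
    (X : Set E) : Prop :=
  IsSetWithAtoms G A X ∧ ∃ S : Finset A, ∃ T : Set E, T.Finite ∧
    X = ⋃ t ∈ T, MulAction.orbit (fixingSubgroup G (S : Set A)) t

/-- The elements of `F`, regarded as objects built without atoms: automorphisms fix all of them. -/
@[ext] structure Atomless (F : Type*) where
  val : F

instance {G F : Type*} [Group G] : MulAction G (Atomless F) where
  smul _ c := c
  one_smul _ := rfl
  mul_smul _ _ _ := rfl

theorem Atomless.smul_eq {G F : Type*} [Group G] (g : G) (c : Atomless F) : g • c = c := rfl

/-- A vector space with atoms over the field `F`: the underlying set is a set with atoms, and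
addition and scalar multiplication (identified with their graphs) are finitely supported. -/
structure VectorSpaceWithAtoms (G A F : Type*) [Group G] [MulAction G A] [Field F] where
  /-- the universe containing the vectors -/
  Ambient : Type u
  [action : MulAction G Ambient]
  /-- the underlying set of the vector space -/
  carrier : Set Ambient
  [addCommGroup : AddCommGroup carrier]
  [module : Module F carrier]
  isSetWithAtoms : IsSetWithAtoms G A carrier
  add_finitelySupported : FinitelySupported G A
    (Set.range fun p : carrier × carrier =>
      (((p.1 : Ambient), (p.2 : Ambient)), ((p.1 + p.2 : carrier) : Ambient)))
  smul_finitelySupported : FinitelySupported G A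
    (Set.range fun p : F × carrier =>
      ((Atomless.mk p.1, (p.2 : Ambient)), ((p.1 • p.2 : carrier) : Ambient)))

attribute [instance] VectorSpaceWithAtoms.action VectorSpaceWithAtoms.addCommGroup
  VectorSpaceWithAtoms.module

/-- Some orbit-finite set of vectors spans the whole space. -/
def VectorSpaceWithAtoms.OrbitFinitelySpanned {G A F : Type*} [Group G] [MulAction G A] [Field F]
    (V : VectorSpaceWithAtoms.{u} G A F) : Prop :=
  ∃ Q : Set V.Ambient, Q ⊆ V.carrier ∧ OrbitFinite G A Q ∧
    Submodule.span F {v : V.carrier | (v : V.Ambient) ∈ Q} = ⊤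

/-- The graph of a function from a set `X` to `F`, as a subset of a type with a `G`-action. -/
def graph {E F : Type*} {X : Set E} (f : X → F) : Set (E × Atomless F) :=
  Set.range fun x : X => ((x : E), Atomless.mk (f x))

section facts

variable {G A F : Type*} [Group G] [MulAction G A]

theorem graph_injective {E F : Type*} {X : Set E} {f f' : X → F} (h : graph f = graph f') :
    f = f' := by
  funext x
  have hx : ((x : E), Atomless.mk (f x)) ∈ graph f' := h ▸ ⟨x, rfl⟩
  obtain ⟨y, hy⟩ := hx
  have h1 := congrArg Prod.fst hy
  have h2 := congrArg (fun p => Atomless.val (Prod.snd p)) hy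
  obtain rfl : y = x := Subtype.ext h1
  exact h2.symm

theorem supports_of_smul_mem {E : Type*} [MulAction G E] {S : Set A} {X : Set E}
    (h : ∀ g : G, (∀ a ∈ S, g • a = a) → ∀ x ∈ X, g • x ∈ X) : MulAction.Supports G S X := by
  intro g hg
  have hg' : ∀ a ∈ S, g⁻¹ • a = a := fun a ha => by
    rw [inv_smul_eq_iff]; exact (hg ha).symm
  apply Set.Subset.antisymm
  · rintro _ ⟨x, hx, rfl⟩
    exact h g (fun a ha => hg ha) x hx
  · intro x hx
    exact ⟨g⁻¹ • x, h _ hg' x hx, smul_inv_smul g x⟩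

theorem FinitelySupported.smul {E : Type*} [MulAction G E] {x : E}
    (h : FinitelySupported G A x) (g : G) : FinitelySupported G A (g • x) := by
  classical
  obtain ⟨S, hS⟩ := h
  refine ⟨S.image (g • ·), fun k hk => ?_⟩
  have : (g⁻¹ * k * g) • x = x := hS _ (fun a ha => by
    have := hk (a := g • a) (by exact_mod_cast Finset.mem_image_of_mem (g • ·) ha)
    rw [mul_smul, mul_smul, this, inv_smul_smul])
  rw [mul_smul, mul_smul, inv_smul_eq_iff] at this
  exact this

theorem smul_graph_eq {E : Type*} [MulAction G E] {X : Set E} {f f' : X → F} {g : G}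
    (e : X ≃ X) (he : ∀ x, (e x : E) = g • (x : E)) (hf : ∀ x, f' (e x) = f x) :
    g • graph f = graph f' := by
  ext p
  constructor
  · rintro ⟨_, ⟨x, rfl⟩, rfl⟩
    exact ⟨e x, Prod.ext (he x) (congrArg Atomless.mk (hf x))⟩
  · rintro ⟨x, rfl⟩
    refine ⟨_, ⟨e.symm x, rfl⟩, Prod.ext ?_ ?_⟩
    · have := he (e.symm x)
      rw [e.apply_symm_apply] at this
      exact this.symm
    · have := hf (e.symm x)
      rw [e.apply_symm_apply] at this
      exact congrArg Atomless.mk this.symm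

theorem smul_graph_iff {E : Type*} [MulAction G E] {X : Set E} {f : X → F} {g : G}
    (h : g • graph f = graph f) (x : X) : ∃ y : X, (y : E) = g • (x : E) ∧ f y = f x := by
  have hx : g • ((x : E), Atomless.mk (f x)) ∈ g • graph f :=
    Set.smul_mem_smul_set ⟨x, rfl⟩
  rw [h] at hx
  obtain ⟨y, hy⟩ := hx
  exact ⟨y, congrArg Prod.fst hy, congrArg (fun p => Atomless.val (Prod.snd p)) hy⟩

/-- Pointwise combinations of finitely supported functions are finitely supported. -/
theorem graph_combine {E : Type*} [MulAction G E] {X : Set E} {f f' k : X → F}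
    (hf : FinitelySupported G A (graph f)) (hf' : FinitelySupported G A (graph f'))
    (hk : ∀ x y, f x = f y → f' x = f' y → k x = k y) : FinitelySupported G A (graph k) := by
  classical
  obtain ⟨S, hS⟩ := hf
  obtain ⟨S', hS'⟩ := hf'
  refine ⟨S ∪ S', supports_of_smul_mem ?_⟩
  rintro g hg _ ⟨x, rfl⟩
  obtain ⟨y, hy, h1⟩ := smul_graph_iff (hS g fun a ha => hg a (by simp; exact Or.inl ha)) x
  obtain ⟨z, hz, h2⟩ := smul_graph_iff (hS' g fun a ha => hg a (by simp; exact Or.inr ha)) x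
  obtain rfl : y = z := Subtype.ext (hy.trans hz.symm)
  exact ⟨y, Prod.ext hy (congrArg Atomless.mk (hk y x h1 h2))⟩

theorem graph_const {E : Type*} [MulAction G E] {X : Set E} (hX : FinitelySupported G A X)
    (c : F) : FinitelySupported G A (graph fun _ : X => c) := by
  obtain ⟨S, hS⟩ := hX
  refine ⟨S, supports_of_smul_mem ?_⟩
  rintro g hg _ ⟨x, rfl⟩
  have : g • (x : E) ∈ g • X := Set.smul_mem_smul_set x.2
  rw [hS g fun a ha => hg a ha] at this
  exact ⟨⟨_, this⟩, rfl⟩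

end facts

namespace VectorSpaceWithAtoms

variable {G A F : Type*} [Group G] [MulAction G A] [Field F]

/-- All automorphisms fixing some finite set of atoms act linearly on the space. -/
theorem exists_linearEquiv (V : VectorSpaceWithAtoms.{u} G A F) :
    ∃ S : Finset A, ∀ g : G, (∀ a ∈ S, g • a = a) →
      ∃ e : V.carrier ≃ₗ[F] V.carrier, ∀ x, (e x : V.Ambient) = g • (x : V.Ambient) := by
  classical
  obtain ⟨S₁, h₁⟩ := V.isSetWithAtoms.1
  obtain ⟨S₂, h₂⟩ := V.add_finitelySupported
  obtain ⟨S₃, h₃⟩ := V.smul_finitelySupported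
  refine ⟨S₁ ∪ S₂ ∪ S₃, fun g hg => ?_⟩
  have k₁ := h₁ g fun a ha => hg a (by simp at ha; simp [ha])
  have k₂ := h₂ g fun a ha => hg a (by simp at ha; simp [ha])
  have k₃ := h₃ g fun a ha => hg a (by simp at ha; simp [ha])
  have mem : ∀ x : V.carrier, g • (x : V.Ambient) ∈ V.carrier := fun x => by
    have := Set.smul_mem_smul_set (a := g) x.2
    rwa [k₁] at this
  have mem' : ∀ x : V.carrier, g⁻¹ • (x : V.Ambient) ∈ V.carrier := fun x => by
    rw [← Set.mem_smul_set_iff_inv_smul_mem, k₁]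
    exact x.2
  refine ⟨{ toFun := fun x => ⟨_, mem x⟩
            invFun := fun x => ⟨_, mem' x⟩
            left_inv := fun x => Subtype.ext (inv_smul_smul _ _)
            right_inv := fun x => Subtype.ext (smul_inv_smul _ _)
            map_add' := ?_
            map_smul' := ?_ }, fun x => rfl⟩
  · intro x y
    have := Set.smul_mem_smul_set (a := g) (Set.mem_range_self (f := fun p : V.carrier × V.carrier =>
      (((p.1 : V.Ambient), (p.2 : V.Ambient)), ((p.1 + p.2 : V.carrier) : V.Ambient))) (x, y))
    rw [k₂] at this
    obtain ⟨⟨x', y'⟩, h⟩ := this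
    have hx : x' = ⟨_, mem x⟩ := Subtype.ext (congrArg (fun p => p.1.1) h)
    have hy : y' = ⟨_, mem y⟩ := Subtype.ext (congrArg (fun p => p.1.2) h)
    subst hx hy
    exact Subtype.ext (congrArg Prod.snd h).symm
  · intro c y
    have := Set.smul_mem_smul_set (a := g) (Set.mem_range_self (f := fun p : F × V.carrier =>
      ((Atomless.mk p.1, (p.2 : V.Ambient)), ((p.1 • p.2 : V.carrier) : V.Ambient))) (c, y))
    rw [k₃] at this
    obtain ⟨⟨c', y'⟩, h⟩ := this
    have hc : c' = c := congrArg (fun p => p.1.1.val) h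
    have hy : y' = ⟨_, mem y⟩ := Subtype.ext (congrArg (fun p => p.1.2) h)
    subst hc hy
    exact Subtype.ext (congrArg Prod.snd h).symm

/-- The finitely supported linear maps from `V` to `F`, with pointwise operations. -/
def finitelySupportedForms (V : VectorSpaceWithAtoms.{u} G A F) :
    Submodule F (V.carrier →ₗ[F] F) where
  carrier := {φ | FinitelySupported G A (graph φ)}
  zero_mem' := graph_const V.isSetWithAtoms.1 0
  add_mem' hφ hψ := graph_combine hφ hψ fun x y h h' => by simp [h, h']
  smul_mem' c φ hφ := graph_combine hφ hφ fun x y h _ => by simp [h]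

/-- The underlying set of the finitely supported dual: the set of graphs of the finitely supported
linear maps from `V` to `F`. -/
def dualCarrier (V : VectorSpaceWithAtoms.{u} G A F) : Set (Set (V.Ambient × Atomless F)) :=
  {γ | ∃ φ : V.carrier →ₗ[F] F, FinitelySupported G A (graph φ) ∧ graph φ = γ}

/-- A finitely supported linear map corresponds to its graph. -/
noncomputable def dualEquiv (V : VectorSpaceWithAtoms.{u} G A F) :
    V.dualCarrier ≃ V.finitelySupportedForms :=
  (Equiv.ofBijective
    (fun φ : V.finitelySupportedForms =>
      (⟨graph (φ : V.carrier →ₗ[F] F), φ, φ.2, rfl⟩ : V.dualCarrier))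
    ⟨fun _ _ h => Subtype.ext (DFunLike.coe_injective (graph_injective (congrArg Subtype.val h))),
      fun ⟨_, φ, hφ, h⟩ => ⟨⟨φ, hφ⟩, Subtype.ext h⟩⟩).symm

/-- Addition of graphs is pointwise addition of the corresponding linear maps. -/
noncomputable instance (V : VectorSpaceWithAtoms.{u} G A F) : AddCommGroup V.dualCarrier :=
  V.dualEquiv.addCommGroup

noncomputable instance (V : VectorSpaceWithAtoms.{u} G A F) : Module F V.dualCarrier :=
  V.dualEquiv.module F

theorem dualEquiv_graph (V : VectorSpaceWithAtoms.{u} G A F) (γ : V.dualCarrier) :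
    graph (V.dualEquiv γ : V.carrier →ₗ[F] F) = (γ : Set (V.Ambient × Atomless F)) :=
  congrArg Subtype.val (V.dualEquiv.symm_apply_apply γ)

theorem exists_dualEquiv_comp (V : VectorSpaceWithAtoms.{u} G A F) :
    ∃ S : Finset A, ∀ g : G, (∀ a ∈ S, g • a = a) →
      ∃ e : V.carrier ≃ₗ[F] V.carrier, ∀ γ : V.dualCarrier, ∃ γ' : V.dualCarrier,
        (γ' : Set (V.Ambient × Atomless F)) = g • (γ : Set (V.Ambient × Atomless F)) ∧
        (V.dualEquiv γ' : V.carrier →ₗ[F] F) = (V.dualEquiv γ : V.carrier →ₗ[F] F) ∘ₗ e := by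
  obtain ⟨S, hS⟩ := V.exists_linearEquiv
  refine ⟨S, fun g hg => ?_⟩
  obtain ⟨e, he⟩ := hS g hg
  refine ⟨e.symm, fun γ => ?_⟩
  have key : g • graph (V.dualEquiv γ : V.carrier →ₗ[F] F) =
      graph ((V.dualEquiv γ : V.carrier →ₗ[F] F) ∘ₗ (e.symm : V.carrier →ₗ[F] V.carrier)) :=
    smul_graph_eq e.toEquiv he fun x => by simp
  have hfs := (V.dualEquiv γ).2.smul g
  rw [key] at hfs
  refine ⟨V.dualEquiv.symm ⟨_, hfs⟩, ?_, by rw [Equiv.apply_symm_apply]⟩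
  rw [← V.dualEquiv_graph γ, key]
  rfl

/-- The finitely supported dual of a vector space with atoms: the vector space of finitely
supported linear maps from `V` to `F`, again a vector space with atoms. -/
noncomputable def dual (V : VectorSpaceWithAtoms.{u} G A F) : VectorSpaceWithAtoms G A F where
  Ambient := Set (V.Ambient × Atomless F)
  carrier := V.dualCarrier
  isSetWithAtoms := by
    refine ⟨?_, ?_⟩
    · obtain ⟨S, hS⟩ := V.exists_dualEquiv_comp
      refine ⟨S, supports_of_smul_mem fun g hg γ hγ => ?_⟩
      obtain ⟨e, he⟩ := hS g hg
      obtain ⟨γ', h, -⟩ := he ⟨γ, hγ⟩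
      exact h ▸ γ'.2
    · rintro _ ⟨φ, hφ, rfl⟩
      exact hφ
  add_finitelySupported := by
    obtain ⟨S, hS⟩ := V.exists_dualEquiv_comp
    refine ⟨S, supports_of_smul_mem ?_⟩
    rintro g hg _ ⟨⟨γ, δ⟩, rfl⟩
    obtain ⟨e, he⟩ := hS g hg
    obtain ⟨γ', h1, k1⟩ := he γ
    obtain ⟨δ', h2, k2⟩ := he δ
    obtain ⟨η, h3, k3⟩ := he (γ + δ)
    refine ⟨(γ', δ'), Prod.ext (Prod.ext h1 h2) (Eq.trans ?_ h3)⟩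
    refine congrArg Subtype.val (V.dualEquiv.injective (Subtype.ext ?_))
    simp only [Equiv.add_def, Equiv.apply_symm_apply, Submodule.coe_add] at k3 ⊢
    rw [k1, k2, k3]
    rfl
  smul_finitelySupported := by
    obtain ⟨S, hS⟩ := V.exists_dualEquiv_comp
    refine ⟨S, supports_of_smul_mem ?_⟩
    rintro g hg _ ⟨⟨c, γ⟩, rfl⟩
    obtain ⟨e, he⟩ := hS g hg
    obtain ⟨γ', h1, k1⟩ := he γ
    obtain ⟨η, h3, k3⟩ := he (c • γ)
    refine ⟨(c, γ'), Prod.ext (Prod.ext rfl h1) (Eq.trans ?_ h3)⟩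
    refine congrArg Subtype.val (V.dualEquiv.injective (Subtype.ext ?_))
    simp only [Equiv.smul_def, Equiv.apply_symm_apply, Submodule.coe_smul] at k3 ⊢
    rw [k1, k3]
    rfl

end VectorSpaceWithAtoms

end Atoms

/-! A form may have an arbitrarily large finite support, yet finitely many orbits must span all
forms. It suffices to work over `ℚ`: a bijection of `ℚ` with `ℕ` turns order automorphisms into
permutations, and orbits under the larger group only enlarge the span.

An orbit-finite spanning set is covered by an equivariant image of `L × ℚᴶ`
(`exists_equivariant_parametrization`), so a form is determined by a function on labelled tuples. In
a linear order, the orbit of a tuple over a finite set `T` is cut out by the elements of `T` nearest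
to each coordinate. Hence a function supported by any `T` combines indicators with parameters in `L
× ℚ^(3J)`, a bound independent of `T` (`mem_range_indicatorMap`). The dual is thus an image of an
invariant subspace of the free space on `L × ℚ^(3J)`. Such subspaces are spanned by finitely many
orbits, by a Gröbner-basis argument (`exists_finite_generators`) in which Higman's lemma
(`exists_orderIso_image_subset`) plays the role of Dickson's. -/

namespace Atoms

/-! ### Homogeneity of the rational order -/

/-- A finite partial isomorphism of `ℚ` extends to an automorphism. -/
theorem exists_orderIso_extend {I : Type*} [Finite I] (p q : I → ℚ)
    (h : ∀ i j, p i ≤ p j ↔ q i ≤ q j) : ∃ g : ℚ ≃o ℚ, ∀ i, g • p i = q i := by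
  classical
  have := Fintype.ofFinite I
  have hcmp : ∀ i j, cmp (p i) (p j) = cmp (q i) (q j) := fun i j => by
    have h₁ : p i < p j ↔ q i < q j := by rw [← not_le, ← not_le, h j i]
    have h₂ : p j < p i ↔ q j < q i := by rw [← not_le, ← not_le, h i j]
    simp only [cmp, cmpUsing, h₁, h₂]
  let f₀ : Order.PartialIso ℚ ℚ := ⟨Finset.univ.image fun i => (p i, q i), by
    simp only [Finset.mem_image, Finset.mem_univ, true_and]
    rintro _ ⟨i, rfl⟩ _ ⟨j, rfl⟩
    exact hcmp i j⟩
  -- Back and forth: an ideal containing `f₀` and meeting these cofinal sets glues to an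
  -- automorphism extending `f₀`.
  let c : ℚ ⊕ ℚ → Order.Cofinal (Order.PartialIso ℚ ℚ) := fun r =>
    Sum.recOn r (Order.PartialIso.definedAtLeft ℚ) (Order.PartialIso.definedAtRight ℚ)
  let K : Order.Ideal (Order.PartialIso ℚ ℚ) := Order.idealOfCofinals f₀ c
  let φ a := Order.PartialIso.funOfIdeal a K (Order.cofinal_meets_idealOfCofinals _ c (Sum.inl a))
  let γ b := Order.PartialIso.invOfIdeal b K (Order.cofinal_meets_idealOfCofinals _ c (Sum.inr b))
  refine ⟨OrderIso.ofCmpEqCmp (fun a => (φ a).val) (fun b => (γ b).val) fun a b => ?_, fun i => ?_⟩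
  · obtain ⟨f, hf, ha⟩ := (φ a).prop
    obtain ⟨f', hf', hb⟩ := (γ b).prop
    obtain ⟨m, _, hm, hm'⟩ := K.directed _ hf _ hf'
    exact m.prop (a, _) (hm ha) (_, b) (hm' hb)
  · change (φ (p i)).val = q i
    obtain ⟨f, hf, ha⟩ := (φ (p i)).prop
    obtain ⟨m, _, hm, hm'⟩ := K.directed _ hf _ (Order.mem_idealOfCofinals f₀ c)
    have := m.prop _ (hm ha) (p i, q i) (hm' (Finset.mem_image_of_mem _ (Finset.mem_univ i)))
    rw [cmp_self_eq_eq, eq_comm, cmp_eq_eq_iff] at this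
    exact this

/-! ### Gröbner-style finite generation -/

/-- Let a monoid act on a linear order `X` by strictly monotone maps. If `X` is exhausted by finite
cells such that pointed cells are well-quasi-ordered by embeddings coming from the action, then
every invariant subspace of the space with basis `X` is spanned by finitely many orbits. -/
theorem exists_finite_generators {F X H κ : Type*} [Field F] [LinearOrder X] [Monoid H]
    [MulAction H X] (hmono : ∀ (g : H) (x y : X), x < y → g • x < g • y) (cell : κ → Set X)
    (hfin : ∀ T, (cell T).Finite) (hcover : ∀ s : Finset X, ∃ T, ↑s ⊆ cell T)
    (hwqo : ∀ (T : ℕ → κ) (x : ℕ → X), (∀ n, x n ∈ cell (T n)) →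
      ∃ i j, i < j ∧ ∃ g : H, g • x i = x j ∧ ∀ y ∈ cell (T i), g • y ∈ cell (T j))
    (U : Submodule F (X →₀ F))
    (hU : ∀ (g : H), ∀ u ∈ U, Finsupp.mapDomain (g • ·) u ∈ U) :
    ∃ B : Set (X →₀ F), B.Finite ∧ B ⊆ U ∧
      U ≤ Submodule.span F {v | ∃ g : H, ∃ b ∈ B, v = Finsupp.mapDomain (g • ·) b} := by
  classical
  -- `Z (T, x) u` says that `u ∈ U` has leading point `x` and support in cell `T`. Recording the
  -- cell keeps translated generators inside the cell of the vector being reduced.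
  let Z : κ × X → (X →₀ F) → Prop := fun z u =>
    u ∈ U ∧ ↑u.support ⊆ cell z.1 ∧ z.2 ∈ u.support ∧ ∀ y ∈ u.support, y ≤ z.2
  let r : κ × X → κ × X → Prop := fun z w =>
    ∃ g : H, g • z.2 = w.2 ∧ ∀ y ∈ cell z.1, g • y ∈ cell w.1
  obtain ⟨N, hN, hbasis⟩ : ∃ N : Finset (κ × X), (∀ z ∈ N, ∃ u, Z z u) ∧
      ∀ w, (∃ u, Z w u) → ∃ z ∈ N, r z w := by
    -- Without a finite basis there is an infinite bad sequence, against `hwqo`.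
    by_contra! hcon
    obtain ⟨f, hf, hbad⟩ := exists_seq_of_forall_finset_exists (fun z => ∃ u, Z z u)
      (fun z w => ¬ r z w) hcon
    obtain ⟨i, j, hij, hr⟩ := hwqo (fun n => (f n).1) (fun n => (f n).2) fun n => by
      obtain ⟨u, -, h₁, h₂, -⟩ := hf n
      exact h₁ h₂
    exact hbad i j hij hr
  choose! b hb using hN
  refine ⟨b '' N, N.finite_toSet.image b, ?_, fun u hu => ?_⟩
  · rintro _ ⟨z, hz, rfl⟩
    exact (hb z hz).1
  set Y := Submodule.span F {v | ∃ g : H, ∃ c ∈ b '' N, v = Finsupp.mapDomain (g • ·) c} with hY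
  by_contra huY
  obtain ⟨T, hT⟩ := hcover u.support
  -- Leading points of counterexamples in one cell. The order on `X` need not be well founded;
  -- finiteness of the cell supplies a minimum.
  let C : Set X := {x | ∃ v, Z (T, x) v ∧ v ∉ Y}
  have top : ∀ v ∈ U, v ∉ Y → ↑v.support ⊆ cell T → ∃ x ∈ v.support, x ∈ C := fun v hv hvY hvT => by
    have hne : v.support.Nonempty := by
      rw [Finsupp.support_nonempty_iff]
      rintro rfl
      exact hvY Y.zero_mem
    exact ⟨_, Finset.max'_mem _ hne, v,
      ⟨hv, hvT, Finset.max'_mem _ hne, fun y hy => Finset.le_max' _ y hy⟩, hvY⟩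
  have hCfin : C.Finite := (hfin T).subset fun x ⟨v, ⟨_, h₁, h₂, _⟩, _⟩ => h₁ h₂
  obtain ⟨x₁, -, hx₁⟩ := top u hu huY hT
  obtain ⟨x, ⟨v, hv, hvY⟩, hmin⟩ := Set.exists_min_image C id hCfin ⟨x₁, hx₁⟩
  obtain ⟨z, hz, g, hgx, hgT⟩ := hbasis (T, x) ⟨v, hv⟩
  obtain ⟨hbU, hbT, hbx, hbmax⟩ := hb z hz
  obtain ⟨hvU, hvT, hvx, hvmax⟩ := hv
  have hinj : Function.Injective (g • · : X → X) :=
    StrictMono.injective fun x y h => hmono g x y h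
  set w := Finsupp.mapDomain (g • · : X → X) (b z) with hw
  have hwx : w x = b z z.2 := by
    have : x = g • z.2 := hgx.symm
    rw [this, hw]
    exact Finsupp.mapDomain_apply hinj _ _
  have hwsupp : ∀ y ∈ w.support, y ∈ cell T ∧ y ≤ x := fun y hy => by
    obtain ⟨y', hy', rfl⟩ := Finset.mem_image.1 (Finsupp.mapDomain_support hy)
    refine ⟨hgT _ (hbT hy'), ?_⟩
    have : x = g • z.2 := hgx.symm
    rw [this]
    rcases (hbmax y' hy').lt_or_eq with h | h
    · exact (hmono g _ _ h).le
    · exact (congrArg (g • ·) h).le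
  have hwY : w ∈ Y := Submodule.subset_span ⟨g, b z, ⟨z, hz, rfl⟩, rfl⟩
  have hbz : b z z.2 ≠ 0 := Finsupp.mem_support_iff.1 hbx
  -- Cancels the coefficient at `x`. The difference is still a counterexample in the cell, so by
  -- minimality it must lead at `x`, where it vanishes.
  set k := v x / b z z.2
  have hd : v - k • w ∈ U := U.sub_mem hvU (U.smul_mem _ (hU g _ hbU))
  have hdY : v - k • w ∉ Y := fun h => hvY <| by
    simpa using Y.add_mem h (Y.smul_mem k hwY)
  have hdsupp : ∀ y ∈ (v - k • w).support, y ∈ cell T ∧ y ≤ x := fun y hy => by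
    rcases Finset.mem_union.1 (Finsupp.support_sub hy) with h | h
    · exact ⟨hvT h, hvmax y h⟩
    · exact hwsupp y (Finsupp.support_smul h)
  obtain ⟨y, hy, hyC⟩ := top _ hd hdY fun y hy => (hdsupp y hy).1
  obtain rfl : y = x := le_antisymm (hdsupp y hy).2 (hmin y hyC)
  refine Finsupp.mem_support_iff.1 hy ?_
  simp [hwx, k, hbz]

end Atoms
namespace Atoms

/-! ### Higman's lemma for marked finite sets of rationals -/

/-- Among infinitely many finite sets of rationals with marked points and labels, some two are
related by an automorphism fixing `S`, which maps the first into the second. -/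
theorem exists_orderIso_image_subset {J L : Type*} [Finite J] [Finite L] (S : Finset ℚ)
    (T : ℕ → Finset ℚ) (l : ℕ → L) (x : ℕ → J → ℚ) (hx : ∀ n j, x n j ∈ T n ∪ S) :
    ∃ i j, i < j ∧ l i = l j ∧ ∃ g : ℚ ≃o ℚ, (∀ s ∈ S, g • s = s) ∧ g • x i = x j ∧
      ∀ t ∈ T i ∪ S, g • t ∈ T j ∪ S := by
  classical
  let p : ℕ → J ⊕ S → ℚ := fun n => Sum.elim (x n) (fun s => s)
  -- A letter is the set of marks on a point, elements of `S` being marks too. Matching letters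
  -- therefore force the automorphism to respect the tuples and fix `S`.
  let letter : ℕ → ℚ → Set (J ⊕ S) := fun n t => {i | p n i = t}
  let srt : ℕ → List ℚ := fun n => (T n ∪ S).sort (· ≤ ·)
  let word : ℕ → List (Set (J ⊕ S)) := fun n => (srt n).map (letter n)
  have hwords : WellQuasiOrdered (List.SublistForall₂ (Eq : Set (J ⊕ S) → Set (J ⊕ S) → Prop)) := by
    intro f
    have := Set.PartiallyWellOrderedOn.partiallyWellOrderedOn_sublistForall₂
      (Eq : Set (J ⊕ S) → Set (J ⊕ S) → Prop) (s := Set.univ)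
      (Set.partiallyWellOrderedOn_univ_iff.2 (Finite.wellQuasiOrdered _))
    exact (Set.partiallyWellOrderedOn_iff_exists_lt.1 this) f fun n y _ => Set.mem_univ y
  obtain ⟨i, j, hij, hl, hw⟩ :=
    (Finite.wellQuasiOrdered (Eq : L → L → Prop)).prod hwords fun n => (l n, word n)
  refine ⟨i, j, hij, hl, ?_⟩
  obtain ⟨w, hw₁, hw₂⟩ := List.sublistForall₂_iff.1 hw
  rw [List.forall₂_eq_eq_eq] at hw₁
  subst hw₁
  obtain ⟨f, hf⟩ := List.sublist_iff_exists_fin_orderEmbedding_get_eq.1 hw₂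
  have hlen : ∀ n, (word n).length = (srt n).length := fun n => List.length_map _
  let a : ∀ n, Fin (word n).length → ℚ := fun n k => (srt n).get (k.cast (hlen n))
  have ha : ∀ n k k', a n k ≤ a n k' ↔ k ≤ k' := fun n k k' => by
    have hs : StrictMono (srt n).get := List.SortedLT.strictMono_get (Finset.sortedLT_sort _)
    exact hs.le_iff_le
  have hmem : ∀ n k, a n k ∈ T n ∪ S := fun n k =>
    (Finset.mem_sort (· ≤ ·)).1 (List.get_mem _ _)
  have hsurj : ∀ n, ∀ t ∈ T n ∪ S, ∃ k, a n k = t := fun n t ht => by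
    obtain ⟨k, hk⟩ := List.get_of_mem ((Finset.mem_sort (· ≤ ·)).2 ht)
    exact ⟨k.cast (hlen n).symm, hk⟩
  have hlet : ∀ n k, (word n).get k = letter n (a n k) := fun n k => by
    simp [word, a]
  obtain ⟨g, hg⟩ := exists_orderIso_extend (a i) (fun k => a j (f k)) fun k k' => by
    rw [ha, ha, f.le_iff_le]
  have hp : ∀ m, p i m ∈ T i ∪ S := by
    rintro (m | ⟨s, hs⟩)
    · exact hx i m
    · exact Finset.mem_union_right _ hs
  have key : ∀ m, g • p i m = p j m := fun m => by
    obtain ⟨k, hk⟩ := hsurj i _ (hp m)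
    have h₁ : m ∈ letter i (a i k) := hk.symm
    rw [← hlet, hf, hlet] at h₁
    rw [← hk, hg]
    exact h₁.symm
  refine ⟨g, fun s hs => key (Sum.inr ⟨s, hs⟩), funext fun m => key (Sum.inl m), fun t ht => ?_⟩
  obtain ⟨k, rfl⟩ := hsurj i t ht
  rw [hg]
  exact hmem _ _

/-- Subspaces of the space with basis `L × ℚᴶ` that are invariant under the automorphisms fixing
`S` are spanned by finitely many orbits. -/
theorem exists_finite_generators_tuples {F : Type*} [Field F] {J L : Type*} [Finite J] [Finite L]
    (S : Finset ℚ) (U : Submodule F (Atomless L × (J → ℚ) →₀ F))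
    (hU : ∀ g ∈ fixingSubgroup (ℚ ≃o ℚ) (S : Set ℚ), ∀ u ∈ U, Finsupp.mapDomain (g • ·) u ∈ U) :
    ∃ B : Set (Atomless L × (J → ℚ) →₀ F), B.Finite ∧ B ⊆ U ∧
      U ≤ Submodule.span F {v | ∃ g ∈ fixingSubgroup (ℚ ≃o ℚ) (S : Set ℚ), ∃ b ∈ B,
        v = Finsupp.mapDomain (g • ·) b} := by
  classical
  obtain ⟨n, ⟨eJ⟩⟩ := Finite.exists_equiv_fin J
  obtain ⟨m, ⟨eL⟩⟩ := Finite.exists_equiv_fin L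
  -- Lexicographic, label first: automorphisms fix labels and preserve the comparison at the first
  -- differing coordinate.
  let enc : Atomless L × (J → ℚ) → Fin m ×ₗ Lex (Fin n → ℚ) := fun x =>
    toLex (eL x.1.val, toLex (x.2 ∘ eJ.symm))
  have henc : Function.Injective enc := fun x y h => by
    have h₁ := congrArg (fun z => (ofLex z).1) h
    have h₂ := congrArg (fun z => ofLex (ofLex z).2) h
    refine Prod.ext (Atomless.ext (eL.injective h₁)) (funext fun j => ?_)
    simpa [enc] using congrFun h₂ (eJ j)
  let _ : LinearOrder (Atomless L × (J → ℚ)) := LinearOrder.lift' enc henc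
  have := exists_finite_generators (F := F) (H := fixingSubgroup (ℚ ≃o ℚ) (S : Set ℚ))
    (κ := Finset ℚ) (X := Atomless L × (J → ℚ)) ?_ (fun T => {x | ∀ j, x.2 j ∈ T ∪ S})
    ?_ ?_ ?_ U fun g => hU g g.2
  · obtain ⟨B, h₁, h₂, h₃⟩ := this
    refine ⟨B, h₁, h₂, h₃.trans (Submodule.span_mono ?_)⟩
    rintro _ ⟨g, b, hb, rfl⟩
    exact ⟨g, g.2, b, hb, rfl⟩
  · rintro ⟨g, hg⟩ x y h
    change enc x < enc y at h
    change enc (g • x) < enc (g • y)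
    rw [Prod.Lex.lt_iff] at h ⊢
    rcases h with h | ⟨h, k, hk, hlt⟩
    · exact Or.inl h
    · exact Or.inr ⟨h, k, fun k' hk' => congrArg g (hk k' hk'), g.strictMono hlt⟩
  · intro T
    have : ((Set.univ : Set (Atomless L)) ×ˢ
        (Set.univ.pi fun _ : J => (↑(T ∪ S) : Set ℚ))).Finite := by
      have : Finite (Atomless L) := Finite.of_injective Atomless.val fun _ _ h => Atomless.ext h
      exact Set.finite_univ.prod (Set.Finite.pi fun _ => (T ∪ S).finite_toSet)
    exact this.subset fun x hx => ⟨trivial, fun j _ => hx j⟩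
  · intro s
    have := Fintype.ofFinite J
    refine ⟨s.biUnion fun x => Finset.univ.image x.2, fun x hx j => Finset.mem_union_left _ ?_⟩
    exact Finset.mem_biUnion.2 ⟨x, hx, Finset.mem_image_of_mem _ (Finset.mem_univ j)⟩
  · intro T x hx
    obtain ⟨i, j, hij, hl, g, hS, hg, hT⟩ := exists_orderIso_image_subset S T
      (fun n => (x n).1.val) (fun n => (x n).2) hx
    refine ⟨i, j, hij, ⟨g, (mem_fixingSubgroup_iff _).2 hS⟩, Prod.ext (Atomless.ext hl) hg,
      fun y hy k => hT _ (hy k)⟩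

/-! ### Indicators of orbits with boundedly many parameters -/

/-- Where `T` has no element on one side of `x`, any `t₀ ∈ T` serves, the condition being vacuous.
Each coordinate thus always gets exactly two parameters. -/
theorem exists_mem_between {T : Finset ℚ} (hT : T.Nonempty) (x : ℚ) :
    ∃ a ∈ T, ∃ b ∈ T, (∀ t ∈ T, x ≤ t → x ≤ b ∧ b ≤ t) ∧ ∀ t ∈ T, t ≤ x → t ≤ a ∧ a ≤ x := by
  classical
  obtain ⟨t₀, ht₀⟩ := hT
  have hb : ∃ b ∈ T, ∀ t ∈ T, x ≤ t → x ≤ b ∧ b ≤ t := by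
    by_cases h : (T.filter (x ≤ ·)).Nonempty
    · have hm := Finset.mem_filter.1 (Finset.min'_mem _ h)
      exact ⟨_, hm.1, fun t ht hxt => ⟨hm.2, Finset.min'_le _ _ (Finset.mem_filter.2 ⟨ht, hxt⟩)⟩⟩
    · exact ⟨t₀, ht₀, fun t ht hxt => (h ⟨t, Finset.mem_filter.2 ⟨ht, hxt⟩⟩).elim⟩
  have ha : ∃ a ∈ T, ∀ t ∈ T, t ≤ x → t ≤ a ∧ a ≤ x := by
    by_cases h : (T.filter (· ≤ x)).Nonempty
    · have hm := Finset.mem_filter.1 (Finset.max'_mem _ h)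
      exact ⟨_, hm.1, fun t ht hxt => ⟨Finset.le_max' _ _ (Finset.mem_filter.2 ⟨ht, hxt⟩), hm.2⟩⟩
    · exact ⟨t₀, ht₀, fun t ht hxt => (h ⟨t, Finset.mem_filter.2 ⟨ht, hxt⟩⟩).elim⟩
  obtain ⟨a, ha, ha'⟩ := ha
  obtain ⟨b, hb, hb'⟩ := hb
  exact ⟨a, ha, b, hb, hb', ha'⟩

/-- The orbit of a labelled tuple under the automorphisms fixing two atoms per coordinate. -/
def cellOrbit {L J : Type*} (z : Atomless L × (J × Fin 3 → ℚ)) : Set (Atomless L × (J → ℚ)) :=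
  {y | y.1 = z.1 ∧ ∃ h : ℚ ≃o ℚ, (∀ j, h • z.2 (j, 1) = z.2 (j, 1)) ∧
    (∀ j, h • z.2 (j, 2) = z.2 (j, 2)) ∧ ∀ j, h • z.2 (j, 0) = y.2 j}

theorem smul_mem_cellOrbit {L J : Type*} {z : Atomless L × (J × Fin 3 → ℚ)}
    {y : Atomless L × (J → ℚ)} (g : ℚ ≃o ℚ) (h : y ∈ cellOrbit z) :
    g • y ∈ cellOrbit (g • z) := by
  obtain ⟨h₁, h, h₂, h₃, h₄⟩ := h
  have key : ∀ q r : ℚ, h • q = r → (g * h * g⁻¹) • g • q = g • r := fun q r e => by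
    rw [mul_smul, mul_smul, inv_smul_smul, e]
  exact ⟨h₁, g * h * g⁻¹, fun j => key _ _ (h₂ j), fun j => key _ _ (h₃ j), fun j => key _ _ (h₄ j)⟩

theorem smul_mem_cellOrbit_iff {L J : Type*} {z : Atomless L × (J × Fin 3 → ℚ)}
    {y : Atomless L × (J → ℚ)} (g : ℚ ≃o ℚ) :
    y ∈ cellOrbit (g • z) ↔ g⁻¹ • y ∈ cellOrbit z := by
  constructor
  · intro h
    simpa using smul_mem_cellOrbit g⁻¹ h
  · intro h
    simpa using smul_mem_cellOrbit g h

/-- The linear map sending a basis vector `z` to the indicator function of `cellOrbit z`. -/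
noncomputable def indicatorMap (F L J : Type*) [Field F] :
    (Atomless L × (J × Fin 3 → ℚ) →₀ F) →ₗ[F] (Atomless L × (J → ℚ) → F) :=
  Finsupp.linearCombination F fun z => (cellOrbit z).indicator 1

/-- Makes the preimage of an invariant space of functions invariant. -/
theorem indicatorMap_mapDomain {F L J : Type*} [Field F] (g : ℚ ≃o ℚ)
    (u : Atomless L × (J × Fin 3 → ℚ) →₀ F) (y : Atomless L × (J → ℚ)) :
    indicatorMap F L J (Finsupp.mapDomain (g • ·) u) y = indicatorMap F L J u (g⁻¹ • y) := by
  classical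
  induction u using Finsupp.induction_linear with
  | zero => simp
  | add u v hu hv => simp [Finsupp.mapDomain_add, hu, hv]
  | single z c =>
    simp [indicatorMap, Finsupp.mapDomain_single, Set.indicator_apply, smul_mem_cellOrbit_iff g]

/-- Finitely supported functions on labelled tuples are combinations of indicator functions of
orbits under the automorphisms fixing two atoms per coordinate. -/
theorem mem_range_indicatorMap {F L J : Type*} [Field F] [Finite L] [Finite J]
    (f : Atomless L × (J → ℚ) → F) (T : Finset ℚ)
    (hf : ∀ g : ℚ ≃o ℚ, (∀ t ∈ T, g • t = t) → ∀ x, f (g • x) = f x) :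
    f ∈ LinearMap.range (indicatorMap F L J) := by
  classical
  wlog hT : T.Nonempty generalizing T
  · exact this (insert 0 T) (fun g hg => hf g fun t ht => hg t (Finset.mem_insert_of_mem ht))
      (Finset.insert_nonempty _ _)
  have : Finite (Atomless L) := Finite.of_injective Atomless.val fun _ _ h => Atomless.ext h
  let pt : Atomless L × (J → ℚ) → J ⊕ T → ℚ := fun x => Sum.elim x.2 fun t => t
  -- Label and order type over `T`: finitely many values, and by homogeneity a complete invariant of
  -- orbits over `T`.
  let τ : Atomless L × (J → ℚ) → Atomless L × (J ⊕ T → J ⊕ T → Prop) :=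
    fun x => (x.1, fun i j => pt x i ≤ pt x j)
  have hτ : ∀ x y, τ x = τ y → ∃ g : ℚ ≃o ℚ, (∀ t ∈ T, g • t = t) ∧ g • x = y := fun x y h => by
    obtain ⟨g, hg⟩ := exists_orderIso_extend (pt x) (pt y) fun i j =>
      iff_of_eq (congrFun (congrFun (congrArg Prod.snd h) i) j)
    exact ⟨g, fun t ht => hg (Sum.inr ⟨t, ht⟩),
      Prod.ext (congrArg Prod.fst h :) (funext fun j => hg (Sum.inl j))⟩
  have hfτ : ∀ x y, τ x = τ y → f x = f y := fun x y h => by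
    obtain ⟨g, hg, rfl⟩ := hτ x y h
    exact (hf g hg x).symm
  have hcell : ∀ x, ∃ z, ∀ y, y ∈ cellOrbit z ↔ τ y = τ x := fun x => by
    choose a ha b hb hub hlb using fun j => exists_mem_between hT (x.2 j)
    refine ⟨(x.1, fun k => ![x.2 k.1, a k.1, b k.1] k.2), fun y => ⟨?_, fun h => ?_⟩⟩
    · rintro ⟨h₁, h, h₂, h₃, h₄⟩
      change ∀ j, h (a j) = a j at h₂
      change ∀ j, h (b j) = b j at h₃
      change ∀ j, h (x.2 j) = y.2 j at h₄
      refine Prod.ext h₁ (funext fun i => funext fun j => propext ?_)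
      rcases i with i | ⟨s, hs⟩ <;> rcases j with j | ⟨t, ht⟩
      · change y.2 i ≤ y.2 j ↔ x.2 i ≤ x.2 j
        rw [← h₄, ← h₄, h.le_iff_le]
      · change y.2 i ≤ t ↔ x.2 i ≤ t
        constructor
        · intro hy
          -- From `t ≤ a i ≤ x.2 i`, applying `h` squeezes `y.2 i = a i`. Then `x.2 i = a i = y.2 i
          -- ≤ t`, a contradiction.
          by_contra! hlt
          obtain ⟨k₁, k₂⟩ := hlb i t ht hlt.le
          have k₃ := h.monotone k₂
          rw [h₂, h₄] at k₃
          have k₄ : y.2 i = a i := le_antisymm (hy.trans k₁) k₃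
          rw [← h₄, ← h₂, h.injective.eq_iff] at k₄
          linarith [h₂ i, h₄ i, congrArg h k₄]
        · intro hx
          obtain ⟨k₁, k₂⟩ := hub i t ht hx
          have k₃ := h.monotone k₁
          rw [h₃, h₄] at k₃
          exact k₃.trans k₂
      · change s ≤ y.2 j ↔ s ≤ x.2 j
        constructor
        · intro hy
          by_contra! hlt
          obtain ⟨k₁, k₂⟩ := hub j s hs hlt.le
          have k₃ := h.monotone k₁
          rw [h₃, h₄] at k₃
          have k₄ : y.2 j = b j := le_antisymm k₃ (k₂.trans hy)
          rw [← h₄, ← h₃, h.injective.eq_iff] at k₄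
          linarith [h₃ j, h₄ j, congrArg h k₄]
        · intro hx
          obtain ⟨k₁, k₂⟩ := hlb j s hs hx
          have k₃ := h.monotone k₂
          rw [h₂, h₄] at k₃
          exact k₁.trans k₃
      · exact Iff.rfl
    · obtain ⟨g, hg, rfl⟩ := hτ x y h.symm
      exact ⟨rfl, g, fun j => hg _ (ha j), fun j => hg _ (hb j), fun j => rfl⟩
  choose z hz using hcell
  have := Fintype.ofFinite (Set.range τ)
  have hsum : f = ∑ θ : Set.range τ, f θ.2.choose • (cellOrbit (z θ.2.choose)).indicator 1 := by
    funext y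
    rw [Finset.sum_apply, Finset.sum_eq_single ⟨τ y, y, rfl⟩]
    · have h := Exists.choose_spec (⟨y, rfl⟩ : ∃ y', τ y' = τ y)
      simp only [Pi.smul_apply, smul_eq_mul]
      rw [Set.indicator_of_mem ((hz _ _).2 h.symm), hfτ _ _ h]
      simp
    · rintro ⟨θ, hθ⟩ - hne
      have h := hθ.choose_spec
      simp only [Pi.smul_apply, smul_eq_mul]
      rw [Set.indicator_of_notMem, mul_zero]
      intro hy
      exact hne (Subtype.ext (((hz _ _).1 hy).trans h).symm)
    · simp
  rw [hsum]
  refine Submodule.sum_mem _ fun θ _ => Submodule.smul_mem _ _ ⟨Finsupp.single (z θ.2.choose) 1, ?_⟩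
  simp [indicatorMap]

end Atoms
namespace Atoms

/-! ### From functions on tuples to linear forms -/

/-- A space of finitely supported linear forms, invariant under the automorphisms fixing `S`, on a
space spanned by an equivariant image of labelled tuples, is spanned by finitely many orbits. -/
theorem exists_finite_generators_forms {F M L J : Type*} [Field F] [AddCommGroup M] [Module F M]
    [Finite L] [Finite J] (S : Finset ℚ) (a : (ℚ ≃o ℚ) → M →ₗ[F] M)
    (ψ : Atomless L × (J → ℚ) → M)
    (hψ : ∀ g ∈ fixingSubgroup (ℚ ≃o ℚ) (S : Set ℚ), ∀ x, ψ (g • x) = a g (ψ x))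
    (hspan : Submodule.span F (Set.range ψ) = ⊤) (D : Submodule F (M →ₗ[F] F))
    (hD : ∀ φ ∈ D, ∀ g ∈ fixingSubgroup (ℚ ≃o ℚ) (S : Set ℚ), φ ∘ₗ a g ∈ D)
    (hfs : ∀ φ ∈ D, ∃ T : Finset ℚ, ∀ g ∈ fixingSubgroup (ℚ ≃o ℚ) (S : Set ℚ),
      (∀ t ∈ T, g • t = t) → φ ∘ₗ a g = φ) :
    ∃ B : Set (M →ₗ[F] F), B.Finite ∧ B ⊆ D ∧
      D ≤ Submodule.span F {φ' | ∃ g ∈ fixingSubgroup (ℚ ≃o ℚ) (S : Set ℚ), ∃ φ ∈ B,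
        φ' = φ ∘ₗ a g} := by
  classical
  let R : (M →ₗ[F] F) →ₗ[F] (Atomless L × (J → ℚ) → F) :=
    { toFun := fun φ x => φ (ψ x)
      map_add' := fun _ _ => rfl
      map_smul' := fun _ _ => rfl }
  have hR : Function.Injective R := fun φ φ' h =>
    LinearMap.ext_on_range hspan fun x => congrFun h x
  obtain ⟨B, hBfin, hBU, hUB⟩ := exists_finite_generators_tuples S
    ((D.map R).comap (indicatorMap F L J)) (by
      rintro g hg u ⟨φ, hφ, hu⟩
      refine ⟨φ ∘ₗ a g⁻¹, hD φ hφ _ (inv_mem hg), funext fun x => ?_⟩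
      rw [indicatorMap_mapDomain, ← hu]
      change φ (a g⁻¹ (ψ x)) = φ (ψ (g⁻¹ • x))
      rw [hψ _ (inv_mem hg)])
  have hBD : ∀ b ∈ B, ∃ φ ∈ D, R φ = indicatorMap F L J b := fun b hb => hBU hb
  choose! θ hθD hθ using hBD
  refine ⟨θ '' B, hBfin.image θ, ?_, fun φ hφ => ?_⟩
  · rintro _ ⟨b, hb, rfl⟩
    exact hθD b hb
  obtain ⟨T, hT⟩ := hfs φ hφ
  obtain ⟨u, hu⟩ := mem_range_indicatorMap (R φ) (S ∪ T) fun g hg x => by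
    have hgS : g ∈ fixingSubgroup (ℚ ≃o ℚ) (S : Set ℚ) :=
      (mem_fixingSubgroup_iff _).2 fun s hs => hg s (Finset.mem_union_left _ hs)
    change φ (ψ (g • x)) = φ (ψ x)
    rw [hψ g hgS]
    exact LinearMap.congr_fun (hT g hgS fun t ht => hg t (Finset.mem_union_right _ ht)) (ψ x)
  have hmem : indicatorMap F L J u ∈ (Submodule.span F {φ' | ∃ g ∈ fixingSubgroup (ℚ ≃o ℚ)
      (S : Set ℚ), ∃ φ ∈ θ '' B, φ' = φ ∘ₗ a g}).map R := by
    -- Every form in `D` lifts to the preimage, whose generators map to translates of the forms `θ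
    -- b`.
    have hle := Submodule.map_mono (f := indicatorMap F L J) hUB
    rw [Submodule.map_span] at hle
    refine Submodule.span_le.2 ?_ (hle ⟨u, ⟨φ, hφ, hu.symm⟩, rfl⟩)
    rintro _ ⟨_, ⟨g, hg, b, hb, rfl⟩, rfl⟩
    refine ⟨θ b ∘ₗ a g⁻¹, Submodule.subset_span ⟨g⁻¹, inv_mem hg, θ b, ⟨b, hb, rfl⟩, rfl⟩,
      funext fun x => ?_⟩
    rw [indicatorMap_mapDomain, ← hθ b hb]
    change θ b (a g⁻¹ (ψ x)) = θ b (ψ (g⁻¹ • x))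
    rw [hψ _ (inv_mem hg)]
  obtain ⟨φ', hφ', he⟩ := hmem
  rw [hu] at he
  exact hR he ▸ hφ'

/-! ### Transfer to vector spaces with atoms -/

namespace VectorSpaceWithAtoms

variable {G A F : Type*} [Group G] [MulAction G A] [Field F]

theorem smul_coe_zero {V : VectorSpaceWithAtoms.{u} G A F} {g : G} {e : V.carrier ≃ₗ[F] V.carrier}
    (he : ∀ x, (e x : V.Ambient) = g • (x : V.Ambient)) :
    g • ((0 : V.carrier) : V.Ambient) = (0 : V.carrier) := by
  rw [← he, map_zero]

theorem graph_comp_eq {V : VectorSpaceWithAtoms.{u} G A F} {g : G} {e : V.carrier ≃ₗ[F] V.carrier}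
    (he : ∀ x, (e x : V.Ambient) = g • (x : V.Ambient)) (φ : V.carrier →ₗ[F] F) :
    graph (φ ∘ₗ (e : V.carrier →ₗ[F] V.carrier)) = g⁻¹ • graph φ := by
  rw [eq_inv_smul_iff]
  exact smul_graph_eq e.toEquiv he fun x => rfl

/-- An orbit-finite spanning set is the image of labelled tuples of atoms under an equivariant
map. -/
theorem exists_equivariant_parametrization (V : VectorSpaceWithAtoms.{u} G A F)
    {Q : Set V.Ambient} (hQV : Q ⊆ V.carrier) (hQ : OrbitFinite G A Q) :
    ∃ (L : Set V.Ambient) (J S : Finset A) (ψ : Atomless L × (J → A) → V.carrier),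
      L.Finite ∧ (∀ x ∈ Q, ∃ z, (ψ z : V.Ambient) = x) ∧
      ∀ g ∈ fixingSubgroup G (S : Set A), ∀ z, (ψ (g • z) : V.Ambient) = g • (ψ z : V.Ambient) := by
  classical
  obtain ⟨hQ₁, S₀, L, hL, rfl⟩ := hQ
  obtain ⟨S₁, hS₁⟩ := V.exists_linearEquiv
  have hmem : ∀ g ∈ fixingSubgroup G (S₀ : Set A), ∀ t ∈ L,
      g • t ∈ ⋃ t ∈ L, MulAction.orbit (fixingSubgroup G (S₀ : Set A)) t := fun g hg t ht =>
    Set.mem_biUnion ht ⟨⟨g, hg⟩, rfl⟩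
  have hfs : ∀ t ∈ L, FinitelySupported G A t := fun t ht => by
    simpa using hQ₁.2 _ (hmem 1 (one_mem _) t ht)
  choose! supp hsupp using hfs
  -- `J` supports every representative, so `g • t` depends only on how `g` moves `J`.
  let J := hL.toFinset.biUnion supp
  have huniq : ∀ g g' : G, ∀ t ∈ L, (∀ j : J, g • (j : A) = g' • (j : A)) → g • t = g' • t :=
    fun g g' t ht h => by
      have := hsupp t ht (g'⁻¹ * g) fun j hj => by
        rw [mul_smul, inv_smul_eq_iff]
        exact h ⟨j, Finset.mem_biUnion.2 ⟨t, hL.mem_toFinset.2 ht, hj⟩⟩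
      rwa [mul_smul, inv_smul_eq_iff] at this
  let P : (J → A) → G → Prop := fun x g =>
    g ∈ fixingSubgroup G (S₀ : Set A) ∧ ∀ j : J, g • (j : A) = x j
  -- Tuples not arising from `J` go to `0`, which linear automorphisms fix, so equivariance
  -- survives.
  let ψ : Atomless L × (J → A) → V.carrier := fun z =>
    if h : ∃ g, P z.2 g then ⟨h.choose • (z.1.val : V.Ambient),
      hQV (hmem _ h.choose_spec.1 _ z.1.val.2)⟩ else 0
  have hψ : ∀ z g, P z.2 g → (ψ z : V.Ambient) = g • (z.1.val : V.Ambient) := fun z g hg => by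
    have h : ∃ g, P z.2 g := ⟨g, hg⟩
    simp only [ψ, dif_pos h]
    exact huniq _ _ _ z.1.val.2 fun j => (h.choose_spec.2 j).trans (hg.2 j).symm
  refine ⟨L, J, S₀ ∪ S₁, ψ, hL, fun x hx => ?_, fun g hg z => ?_⟩
  · obtain ⟨t, ht, ⟨g, hg⟩, rfl⟩ := Set.mem_iUnion₂.1 hx
    exact ⟨(⟨⟨t, ht⟩⟩, fun j => g • (j : A)), hψ _ g ⟨hg, fun j => rfl⟩⟩
  · rw [mem_fixingSubgroup_iff] at hg
    obtain ⟨e, he⟩ := hS₁ g fun s hs => hg s (by simp [hs])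
    have hg₀ : g ∈ fixingSubgroup G (S₀ : Set A) :=
      (mem_fixingSubgroup_iff _).2 fun s hs => hg s (by simp at hs; simp [hs])
    have hP : ∀ (x : J → A) (k h : G), k ∈ fixingSubgroup G (S₀ : Set A) → P x h →
        P (k • x) (k * h) := fun x k h hk hh =>
      ⟨mul_mem hk hh.1, fun j => by rw [mul_smul, hh.2]; rfl⟩
    by_cases h : ∃ h, P z.2 h
    · obtain ⟨h, hh⟩ := h
      rw [hψ z h hh, hψ (g • z) (g * h) (hP _ _ _ hg₀ hh), mul_smul]
      rfl
    · have h' : ¬ ∃ h, P (g • z).2 h := fun ⟨k, hk⟩ => h ⟨g⁻¹ * k, by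
        simpa using hP _ _ _ (inv_mem hg₀) hk⟩
      simp only [ψ, dif_neg h, dif_neg h']
      exact (smul_coe_zero he).symm

/-- If the atoms can be ordered like the rationals so that order automorphisms are atom
automorphisms, then duals of orbit-finitely spanned spaces are orbit-finitely spanned. -/
theorem OrbitFinitelySpanned.dual (ρ : (ℚ ≃o ℚ) →* G) (ε : ℚ ≃ A)
    (hε : ∀ g q, ε (g • q) = ρ g • ε q) {V : VectorSpaceWithAtoms.{u} G A F}
    (hV : V.OrbitFinitelySpanned) : V.dual.OrbitFinitelySpanned := by
  classical
  obtain ⟨Q, hQV, hQ, hspan⟩ := hV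
  obtain ⟨L, J, S₁, ψ, hL, hQψ, hψ⟩ := V.exists_equivariant_parametrization hQV hQ
  obtain ⟨S₂, hS₂⟩ := V.exists_linearEquiv
  have hlin : ∀ g ∈ fixingSubgroup G ((S₁ ∪ S₂ : Finset A) : Set A),
      ∃ e : V.carrier ≃ₗ[F] V.carrier, ∀ x, (e x : V.Ambient) = g • (x : V.Ambient) :=
    fun g hg => hS₂ g fun s hs => (mem_fixingSubgroup_iff _).1 hg s (by simp [hs])
  choose! e he using hlin
  set S := S₁ ∪ S₂ with hS
  have hρ : ∀ (T : Finset A) (g : ℚ ≃o ℚ), (∀ t ∈ T.map ε.symm.toEmbedding, g • t = t) →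
      ∀ t ∈ T, ρ g • t = t := fun T g hg t ht => by
    obtain ⟨q, rfl⟩ := ε.surjective t
    rw [← hε, hg q (Finset.mem_map.2 ⟨_, ht, by simp⟩)]
  have hρS : ∀ g ∈ fixingSubgroup (ℚ ≃o ℚ) ((S.map ε.symm.toEmbedding : Finset ℚ) : Set ℚ),
      ρ g ∈ fixingSubgroup G (S : Set A) := fun g hg =>
    (mem_fixingSubgroup_iff _).2 (hρ S g ((mem_fixingSubgroup_iff _).1 hg))
  have : Finite L := hL
  have hgen := exists_finite_generators_forms (F := F) (L := L) (J := J)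
    (S.map ε.symm.toEmbedding) (fun g => (e (ρ g) : V.carrier →ₗ[F] V.carrier))
    (fun z => ψ (z.1, ε ∘ z.2)) (fun g hg z => ?_) ?_ V.finitelySupportedForms
    (fun φ hφ g hg => ?_) fun φ hφ => ?_
  · obtain ⟨B, hBfin, hBD, hDB⟩ := hgen
    have hcarrier : ∀ γ ∈ graph '' (DFunLike.coe '' B), ∀ g ∈ fixingSubgroup G (S : Set A),
        g • γ ∈ V.dualCarrier := by
      rintro _ ⟨_, ⟨φ, hφ, rfl⟩, rfl⟩ g hg
      have := graph_comp_eq (he _ (inv_mem hg)) φ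
      rw [inv_inv] at this
      rw [← this]
      exact ⟨_, this ▸ (hBD hφ).smul g, rfl⟩
    -- Orbits are taken under all of `G` fixing `S`, although translates by the image of `ρ` already
    -- span.
    have hsub : ⋃ γ ∈ graph '' (DFunLike.coe '' B),
        MulAction.orbit (fixingSubgroup G (S : Set A)) γ ⊆ V.dualCarrier := by
      intro γ hγ
      obtain ⟨δ, hδ, ⟨g, hg⟩, rfl⟩ := Set.mem_iUnion₂.1 hγ
      exact hcarrier δ hδ g hg
    refine ⟨_, hsub, ⟨⟨⟨S, supports_of_smul_mem fun g hg γ hγ => ?_⟩,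
      fun γ hγ => V.dual.isSetWithAtoms.2 γ (hsub hγ)⟩, S, _, (hBfin.image _).image _, rfl⟩, ?_⟩
    · obtain ⟨δ, hδ, ⟨h, hh⟩, rfl⟩ := Set.mem_iUnion₂.1 hγ
      exact Set.mem_biUnion hδ ⟨⟨g * h, mul_mem ((mem_fixingSubgroup_iff _).2 hg) hh⟩,
        mul_smul g h δ⟩
    · let E : V.dualCarrier ≃ₗ[F] V.finitelySupportedForms := V.dualEquiv.linearEquiv F
      let E' : V.dualCarrier →ₗ[F] (V.carrier →ₗ[F] F) :=
        V.finitelySupportedForms.subtype ∘ₗ (E : V.dualCarrier →ₗ[F] V.finitelySupportedForms)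
      have hE' : Function.Injective E' := Subtype.val_injective.comp E.injective
      refine eq_top_iff.2 fun (v : V.dualCarrier) _ => ?_
      have hv : E' v ∈ (Submodule.span F {v : V.dualCarrier | (v : Set (V.Ambient × Atomless F)) ∈
          ⋃ γ ∈ graph '' (DFunLike.coe '' B),
            MulAction.orbit (fixingSubgroup G (S : Set A)) γ}).map E' := by
        refine Submodule.span_le.2 ?_ (hDB (E v).2)
        rintro _ ⟨g, hg, φ, hφ, rfl⟩
        have hgr := graph_comp_eq (he _ (hρS g hg)) φ
        have hfs : φ ∘ₗ (e (ρ g) : V.carrier →ₗ[F] V.carrier) ∈ V.finitelySupportedForms := by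
          change FinitelySupported G A _
          rw [hgr]
          exact (hBD hφ).smul _
        refine ⟨E.symm ⟨_, hfs⟩, Submodule.subset_span ?_, ?_⟩
        · change graph (φ ∘ₗ (e (ρ g) : V.carrier →ₗ[F] V.carrier)) ∈
            ⋃ γ ∈ graph '' (DFunLike.coe '' B), MulAction.orbit (fixingSubgroup G (S : Set A)) γ
          rw [hgr]
          exact Set.mem_biUnion ⟨_, ⟨φ, hφ, rfl⟩, rfl⟩ ⟨⟨(ρ g)⁻¹, inv_mem (hρS g hg)⟩, rfl⟩
        · exact congrArg Subtype.val (E.apply_symm_apply _)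
      obtain ⟨w, hw, hwv⟩ := hv
      exact hE' hwv ▸ hw
  · have h₁ : ρ g ∈ fixingSubgroup G (S₁ : Set A) := (mem_fixingSubgroup_iff _).2 fun s hs =>
      (mem_fixingSubgroup_iff _).1 (hρS g hg) s (by simp at hs; simp [hS, hs])
    refine Subtype.ext (Eq.trans ?_ (he _ (hρS g hg) _).symm)
    rw [← hψ _ h₁]
    have : ε ∘ (g • z).2 = (ρ g • (z.1, ε ∘ z.2) : Atomless L × (J → A)).2 :=
      funext fun j => hε g (z.2 j)
    exact congrArg (fun x => (ψ (z.1, x) : V.Ambient)) this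
  · rw [eq_top_iff, ← hspan]
    refine Submodule.span_mono fun v hv => ?_
    obtain ⟨z, hz⟩ := hQψ v hv
    refine ⟨(z.1, ε.symm ∘ z.2), Subtype.ext (Eq.trans ?_ hz)⟩
    simp [← Function.comp_assoc]
  · change FinitelySupported G A _
    rw [graph_comp_eq (he _ (hρS g hg)) φ]
    exact FinitelySupported.smul hφ _
  · obtain ⟨T, hT⟩ := hφ
    refine ⟨T.map ε.symm.toEmbedding, fun g hg hgT => DFunLike.coe_injective (graph_injective ?_)⟩
    rw [graph_comp_eq (he _ (hρS g hg)) φ, inv_smul_eq_iff]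
    exact (hT (ρ g) (hρ T g hgT)).symm

end VectorSpaceWithAtoms

end Atoms

/-- The equality atoms are `ℕ` with all permutations as atom automorphisms; the ordered atoms are
`ℚ` with all order-preserving bijections. -/
theorem mainTheorem6 (F : Type*) [Field F] :
    (∀ V : Atoms.VectorSpaceWithAtoms.{u} (Equiv.Perm ℕ) ℕ F,
      V.OrbitFinitelySpanned → V.dual.OrbitFinitelySpanned) ∧
    (∀ V : Atoms.VectorSpaceWithAtoms.{u} (ℚ ≃o ℚ) ℚ F,
      V.OrbitFinitelySpanned → V.dual.OrbitFinitelySpanned) := by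
  refine ⟨fun V hV => ?_, fun V hV => hV.dual (MonoidHom.id _) (Equiv.refl ℚ) fun _ _ => rfl⟩
  let ε : ℚ ≃ ℕ := Denumerable.eqv ℚ
  let ρ : (ℚ ≃o ℚ) →* Equiv.Perm ℕ :=
    { toFun := fun g => (ε.symm.trans g.toEquiv).trans ε
      map_one' := Equiv.ext fun n => ε.apply_symm_apply n
      map_mul' := fun g h => Equiv.ext fun n => by simp }
  exact hV.dual ρ ε fun g q => by simp [ρ]
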